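/- **Setting.** Let $G=(V,E)$ be a fixed connected simple undirected graph with $V=\{1,\dots,n\}$. We observe $Y_i=\mu^*_i+\varepsilon_i$, $i\in V$, where the $\varepsilon_i$ are i.i.d., centred and sub-Gaussian with parameter $\sigma>0$, i.e. $\mathbb{E}e^{t\varepsilon_i}\le e^{\sigma^2t^2/2}$ for all $t\in\mathbb{R}$. The mean vector $\mu^*$ is constant on each element of a partition $\mathcal{S}^*=\{S_1^*,\dots,S_{K^*}^*\}$ of $V$, with different values on elements that are joined by an edge. For $e\in E$ let $r(e)$ be the effective resistance weight, i.e. the number of spanning trees of $G$ that include $e$ divided by the number of spanning trees of $G$. Let $w:E\to\mathbb{R}_+$ with $w(e)\ge r(e)$ for all $e\in E$, and put $w(|E|)=\sum_{e\in E}w(e)$ and $$F_w(\mu)=\tfrac12\|Y-\mu\|^2+\lambda\sum_{\{i,j\}\in E}w(i,j)\mathbf 1\{\mu_i\ne\mu_j\}.$$ **Algorithm.** Given $c\in\mathbb{R}$ and $\mu\in\mathbb{R}^n$, an $\alpha$-expansion of $\mu$ with value $c$ is obtained as follows. Form a weighted graph with terminals $s,t$ and the vertices of $V$. Give $\{s,i\}$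 the weight $(Y_i-c)^2/2$, and give $\{t,i\}$ the weight $(Y_i-\mu_i)^2/2$ if $\mu_i\ne c$ and $\infty$ if $\mu_i=c$. An edge $\{i,j\}\in E$ with $\mu_i=\mu_j$ gets the weight $\lambda w(i,j)\mathbf 1\{\mu_i\ne c\}$. An edge $\{i,j\}\in E$ with $\mu_i\neq\mu_j$ is replaced by a new vertex $a_{ij}$ and the edges $\{i,a_{ij}\}$, $\{j,a_{ij}\}$, $\{t,a_{ij}\}$ with weights $\lambda w(i,j)\mathbf 1\{\mu_i\ne c\}$, $\lambda w(i,j)\mathbf 1\{\mu_j\ne c\}$, $\lambda w(i,j)$. Take a minimum $s$-$t$-cut; vertices of $V$ on the side of $t$ receive the value $c$, the others keep the value $\mu_i$. The main algorithm starts from $\bar\mu=(\bar Y,\dots,\bar Y)$, where $\bar Y=n^{-1}\sum_iY_i$, from $\mu_1=0$ and from $\mathrm{FLAG}=0$. For each $c\in\delta\mathbb{Z}\cap[\min_iY_i,\max_iY_i]$ it computes an $\alpha$-expansion $\tilde\mu$ of $\bar\mu$ with value $c$; if $F_w(\tilde\mu)\le F_w(\bar\mu)-\tau$, it sets $\mathrm{FLAG}=1$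 and, if moreover $F_w(\tilde\mu)\le F_w(\mu_1)$, it replaces $\mu_1$ by $\tilde\mu$. If $\mathrm{FLAG}=0$ at the end, it sets $\mu_1=\bar\mu$. The output is $\hat\mu=\mu_1$, and $\widehat{\mathcal S}$ is the partition induced by $\hat\mu$, i.e. the partition of $V$ with the fewest elements on each of which $\hat\mu$ is constant. **Proposition.** There are absolute constants $C_0,c>0$ such that the following holds for every $C_\lambda\ge C_0$. If $K^*=1$, $0<\delta\le\sigma/\sqrt n$, $0\le\tau\le\sigma^2$, $\lambda=C_\lambda\sigma^2\log\{w(|E|)\}$ and $w\ge r$, then with probability at least $1-\{w(|E|)\}^{-c}$ every output $\hat\mu$ of the algorithm (for every order of the loop and every choice of minimum cuts) satisfies $|\widehat{\mathcal S}|=1$, i.e. $\hat\mu$ is constant over the whole graph. (In the degenerate case $n=1$, where $w(|E|)=0$, the probability bound is read as $1$ and the value of $\lambda$ is immaterial.) -/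

import Mathlib

open MeasureTheory ProbabilityTheory
open scoped ENNReal NNReal

noncomputable section

namespace GraphPartition

/-! ### Partitions, edge weights and the piecewise constant model -/

/-- The vector `v` is constant on every element of the partition `S`. -/
def ConstantOnParts {V : Type*} [Fintype V] [DecidableEq V] (v : V → ℝ)
    (S : Finpartition (Finset.univ : Finset V)) : Prop :=
  ∀ A ∈ S.parts, ∀ i ∈ A, ∀ j ∈ A, v i = v j

open Classical in
/-- The partition induced by `v`: the vertices are grouped according to the value of `v`. -/
def inducedPartition {V : Type*} [Fintype V] [DecidableEq V] (v : V → ℝ) :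
    Finpartition (Finset.univ : Finset V) :=
  Finpartition.ofSetoid (Setoid.ker v)

/-- `v` is constant on the elements of the induced partition, and any other partition
with this property has at least as many elements. -/
theorem inducedPartition_isLeast {V : Type*} [Fintype V] [DecidableEq V] (v : V → ℝ) :
    ConstantOnParts v (inducedPartition v) ∧
      ∀ S : Finpartition (Finset.univ : Finset V), ConstantOnParts v S →
        (inducedPartition v).parts.card ≤ S.parts.card := by
  classical
  refine ⟨?_, ?_⟩
  · intro A hA i hi j hj
    have h1 : (inducedPartition v).part i = A := (inducedPartition v).part_eq_of_mem hA hi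
    rw [← h1] at hj
    have h2 : (Setoid.ker v) i j := by
      have := (Finpartition.mem_part_ofSetoid_iff_rel (s := Setoid.ker v) (a := i) (b := j))
      unfold inducedPartition at hj
      exact this.1 (by convert hj)
    exact h2
  · intro S hS
    have hle : S ≤ inducedPartition v := by
      intro A hA
      obtain ⟨i, hi⟩ := S.nonempty_of_mem_parts hA
      refine ⟨(inducedPartition v).part i,
        (inducedPartition v).part_mem.2 (Finset.mem_univ i), ?_⟩
      intro j hj
      have hij : (Setoid.ker v) i j := hS A hA i hi j hj
      have := (Finpartition.mem_part_ofSetoid_iff_rel (s := Setoid.ker v) (a := i) (b := j))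
      unfold inducedPartition
      convert this.2 hij
    exact Finpartition.card_mono hle

/-- Effective resistance weight of `e`: the proportion of the spanning trees of `G`
that include the edge `e`. -/
def effectiveResistance {V : Type*} (G : SimpleGraph V) (e : Sym2 V) : ℝ :=
  ({T : SimpleGraph V | T ≤ G ∧ T.IsTree ∧ e ∈ T.edgeSet}.ncard : ℝ) /
    ({T : SimpleGraph V | T ≤ G ∧ T.IsTree}.ncard : ℝ)

open Classical in
/-- Total weight of the edges of `G`. -/
def totalWeight {V : Type*} [Fintype V] (G : SimpleGraph V) (w : Sym2 V → ℝ) : ℝ :=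
  ∑ e ∈ G.edgeFinset, w e

/-- `S` is a partition supporting the constancy regions of the mean vector `μ`: on each
element `A` of `S` the vector `μ` has the value `f A`, and elements of `S` that are joined by
an edge have different values. -/
structure SupportsSignal {V : Type*} [Fintype V] [DecidableEq V] (G : SimpleGraph V)
    (μ : V → ℝ) (S : Finpartition (Finset.univ : Finset V)) (f : Finset V → ℝ) : Prop where
  value : ∀ A ∈ S.parts, ∀ i ∈ A, μ i = f A
  separated : ∀ A ∈ S.parts, ∀ B ∈ S.parts, A ≠ B →
    (∃ i ∈ A, ∃ j ∈ B, G.Adj i j) → f A ≠ f B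

/-- The signal-plus-noise model on a connected graph, with a piecewise constant mean vector and
centred i.i.d. sub-Gaussian noise: `E exp(t ε_i) ≤ exp(σ² t² / 2)` for all real `t`. -/
structure IsGraphModel {V Ω : Type*} [Fintype V] [DecidableEq V] [MeasurableSpace Ω]
    (P : Measure Ω) (G : SimpleGraph V) (Y ε : V → Ω → ℝ) (σ : ℝ≥0) (μ : V → ℝ)
    (S : Finpartition (Finset.univ : Finset V)) (f : Finset V → ℝ) : Prop where
  connected : G.Connected
  observation : ∀ i ω, Y i ω = μ i + ε i ω
  signal : SupportsSignal G μ S f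
  measurable_noise : ∀ i, Measurable (ε i)
  independent : iIndepFun ε P
  identDistrib : ∀ i j, IdentDistrib (ε i) (ε j) P P
  centred : ∀ i, ∫ ω, ε i ω ∂P = 0
  sigma_pos : 0 < σ
  subGaussian : ∀ i, HasSubgaussianMGF (ε i) (σ ^ 2) P

/-! ### The objective function -/

open Classical in
/-- `½‖Y - μ‖² + lam · ∑_{{i,j} ∈ E} w(i,j) 1{μ_i ≠ μ_j}`. -/
def objective {V : Type*} [Fintype V] (G : SimpleGraph V) (Y : V → ℝ) (lam : ℝ)
    (w : Sym2 V → ℝ) (μ : V → ℝ) : ℝ :=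
  (1 / 2) * ∑ i, (Y i - μ i) ^ 2 +
    lam * ∑ e ∈ G.edgeFinset, if (e.map μ).IsDiag then 0 else w e

/-! ### The `α`-expansion step through a minimum `s`-`t`-cut -/

/-- Vertices of the augmented graph: the terminals `s` and `t`, the original vertices, and an
auxiliary vertex for each edge. Only the auxiliary vertices of edges `{i,j}` with `μ_i ≠ μ_j` are
joined to other vertices; the remaining ones are isolated and do not influence any cut. -/
inductive CutVertex (V : Type*) where
  | source : CutVertex V
  | sink : CutVertex V
  | node (i : V) : CutVertex V
  | aux (e : Sym2 V) : CutVertex V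

open Classical in
/-- Symmetric edge weights of the augmented graph; pairs that are not joined get weight `0`. -/
def capacity {V : Type*} (G : SimpleGraph V) (Y : V → ℝ) (lam : ℝ)
    (w : Sym2 V → ℝ) (c : ℝ) (μ : V → ℝ) : CutVertex V → CutVertex V → ℝ≥0∞
  | .source, .node i | .node i, .source => ENNReal.ofReal ((Y i - c) ^ 2 / 2)
  | .sink, .node i | .node i, .sink =>
      if μ i = c then ⊤ else ENNReal.ofReal ((Y i - μ i) ^ 2 / 2)
  | .node i, .node j =>
      if G.Adj i j ∧ μ i = μ j ∧ μ i ≠ c then ENNReal.ofReal (lam * w s(i, j)) else 0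
  | .node i, .aux e | .aux e, .node i =>
      if e ∈ G.edgeSet ∧ ¬ (e.map μ).IsDiag ∧ i ∈ e ∧ μ i ≠ c then
        ENNReal.ofReal (lam * w e) else 0
  | .sink, .aux e | .aux e, .sink =>
      if e ∈ G.edgeSet ∧ ¬ (e.map μ).IsDiag then ENNReal.ofReal (lam * w e) else 0
  | _, _ => 0

/-- Total weight of the edges between `S` and its complement. -/
def cutCost {X : Type*} (cap : X → X → ℝ≥0∞) (S : Set X) : ℝ≥0∞ :=
  ∑' u : S, ∑' v : (Sᶜ : Set X), cap u v

/-- `(S, Sᶜ)` is a minimum `s`-`t`-cut. -/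
def IsMinCut {X : Type*} (cap : X → X → ℝ≥0∞) (s t : X) (S : Set X) : Prop :=
  (s ∈ S ∧ t ∉ S) ∧ ∀ S' : Set X, s ∈ S' → t ∉ S' → cutCost cap S ≤ cutCost cap S'

open Classical in
/-- `μ'` is a possible result of the `α`-expansion of `μ` with value `c`: for some minimum cut,
vertices on the `t` side receive the value `c` and those on the `s` side keep their value. -/
def IsAlphaExpansion {V : Type*} (G : SimpleGraph V) (Y : V → ℝ) (lam : ℝ)
    (w : Sym2 V → ℝ) (c : ℝ) (μ μ' : V → ℝ) : Prop :=
  ∃ S : Set (CutVertex V), IsMinCut (capacity G Y lam w c μ) .source .sink S ∧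
    ∀ i, μ' i = if CutVertex.node i ∈ S then μ i else c

/-! ### The main algorithm -/

/-- The sample mean, as a constant vector. -/
def meanVector {V : Type*} [Fintype V] (Y : V → ℝ) : V → ℝ :=
  fun _ => (∑ i, Y i) / (Fintype.card V : ℝ)

/-- The candidate values `c ∈ δℤ ∩ [min Y, max Y]`. -/
def candidateValues {V : Type*} (Y : V → ℝ) (δ : ℝ) : Set ℝ :=
  {c | (∃ m : ℤ, c = m * δ) ∧ c ∈ Set.Icc (⨅ i, Y i) (⨆ i, Y i)}

open Classical in
/-- One pass of the loop. The state is `(μ₁, FLAG)`, the initial vector is `μ₀`, the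
proposal is `μ'`. -/
def loopStep {V : Type*} (F : (V → ℝ) → ℝ) (τ : ℝ) (μ₀ : V → ℝ)
    (st : (V → ℝ) × Bool) (μ' : V → ℝ) : (V → ℝ) × Bool :=
  if F μ' ≤ F μ₀ - τ then
    (if F μ' ≤ F st.1 then μ' else st.1, true)
  else st

/-- `out` is a possible output of the algorithm on the data `Y`. The loop visits each candidate
value once, in the order of the list `l`; `prop c` is the result of the `α`-expansion
for the value `c` (any minimum cut may be used). -/
def IsPottsOutput {V : Type*} [Fintype V] (G : SimpleGraph V) (Y : V → ℝ)
    (δ τ lam : ℝ) (w : Sym2 V → ℝ) (out : V → ℝ) : Prop :=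
  ∃ (l : List ℝ) (prop : ℝ → V → ℝ),
    l.Nodup ∧ (∀ c, c ∈ l ↔ c ∈ candidateValues Y δ) ∧
    (∀ c ∈ l, IsAlphaExpansion G Y lam w c (meanVector Y) (prop c)) ∧
    let final := (l.map prop).foldl
      (loopStep (objective G Y lam w) τ (meanVector Y)) ((fun _ => 0), false)
    out = if final.2 = true then final.1 else meanVector Y

end GraphPartition

end

/-! Write `X_B` for the sum over `B` of the deviations from the sample mean `m`, and `∂B` for the
edge cut of `B`. An expansion of the constant vector `m` takes the value `c` on some `B` and `m`
elsewhere. Minimising over `c`, it changes the objective by at least `λ w(∂B) - X_B² / (2|B|)`. If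
this is positive for every proper `B` (`CutsDominate`), every accepted proposal is constant, hence
so is the output (`IsPottsOutput.const`).

Each `X_B` is sub-Gaussian with proxy `|B| σ²`, so `B` fails with probability at most `2 x ^ r(∂B)`,
where `x = exp (-λ / σ²)`. The union bound over exponentially many `B` works because `r(∂B)` is the
mean number of edges of a uniform spanning tree that cross `B`. Jensen reduces the sum to single
trees, where `B` is determined up to complement by its crossing edges
(`sum_rpow_effectiveResistance_le`). This gives at most `4 ((1 + x) ^ (n - 1) - 1)`, and Foster's
theorem gives `n - 1 ≤ W`, with `W` the total weight. For `W ≥ 2` this is below `W⁻¹`.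

If `W < 2` then `n ≤ 2`. One vertex is trivial. For two vertices `λ` may be arbitrarily small, and
the bound comes instead from two independent copies of the noise being close with sufficient
probability (`le_measureReal_abs_sub_lt`). -/

noncomputable section

namespace GraphPartition

/-! ### Edge cuts and spanning trees -/

section Cuts

variable {V : Type*} [Fintype V]

open Classical in
/-- The edges of `G` that join `B` to its complement. -/
def cutEdges (G : SimpleGraph V) (B : Finset V) : Finset (Sym2 V) :=
  G.edgeFinset.filter fun e => ¬ (e.map (· ∈ B)).IsDiag

theorem mk_mem_cutEdges {G : SimpleGraph V} {B : Finset V} {i j : V} :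
    s(i, j) ∈ cutEdges G B ↔ G.Adj i j ∧ ¬ (i ∈ B ↔ j ∈ B) := by
  simp [cutEdges]

/-- Along a walk, membership in a set flips exactly at the edges of its cut, so agreement at the
start propagates. -/
theorem mem_iff_of_cutEdges_eq {T : SimpleGraph V} {B B' : Finset V}
    (h : cutEdges T B = cutEdges T B') {u v : V} (huv : T.Reachable u v)
    (hu : u ∈ B ↔ u ∈ B') : v ∈ B ↔ v ∈ B' := by
  obtain ⟨p⟩ := huv
  induction p with
  | nil => exact hu
  | @cons a b _ hab _ ih =>
    apply ih
    have h1 := mk_mem_cutEdges (G := T) (B := B) (i := a) (j := b)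
    have h2 := mk_mem_cutEdges (G := T) (B := B') (i := a) (j := b)
    rw [h] at h1
    have h3 := h1.symm.trans h2
    simp only [hab, true_and, not_iff_not, hu] at h3
    by_cases ha : a ∈ B' <;> simpa [ha, not_iff_not] using h3

/-- In a connected graph a vertex set is determined by its edge cut and one membership. -/
theorem eq_of_cutEdges_eq {T : SimpleGraph V} (hT : T.Connected) {B B' : Finset V}
    (h : cutEdges T B = cutEdges T B') (v : V) (hv : v ∈ B ↔ v ∈ B') : B = B' := by
  ext u
  exact mem_iff_of_cutEdges_eq h (hT.preconnected v u) hv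

theorem cutEdges_nonempty {T : SimpleGraph V} (hT : T.Connected) {B : Finset V}
    (hB : B.Nonempty) (hB' : B ≠ Finset.univ) : (cutEdges T B).Nonempty := by
  by_contra hne
  rw [Finset.not_nonempty_iff_eq_empty] at hne
  obtain ⟨v, hv⟩ := hB
  apply hB'
  refine eq_of_cutEdges_eq hT (v := v) ?_ (by simp [hv])
  rw [hne]
  symm
  rw [Finset.eq_empty_iff_forall_notMem]
  intro e
  induction e with
  | _ i j => simp [mk_mem_cutEdges]

open Classical in
/-- The vertex sets that define an edge cut: neither empty nor everything. -/
def properSets (V : Type*) [Fintype V] : Finset (Finset V) :=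
  Finset.univ.filter fun B => B.Nonempty ∧ B ≠ Finset.univ

theorem mem_properSets {B : Finset V} :
    B ∈ properSets V ↔ B.Nonempty ∧ B ≠ Finset.univ := by
  simp [properSets]

-- The map sending `B` to its cut and the bit `v ∈ B` is injective, and the cut is never empty. So
-- the binomial theorem without its empty term bounds the sum, and the bit contributes the factor 2.
open Classical in
theorem sum_pow_card_cutEdges_le {T : SimpleGraph V} (hT : T.Connected) {x : ℝ} (hx : 0 ≤ x) :
    ∑ B ∈ properSets V, x ^ (cutEdges T B).card
      ≤ 2 * ((1 + x) ^ T.edgeFinset.card - 1) := by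
  obtain ⟨v⟩ := hT.nonempty
  let g : Finset V → Finset (Sym2 V) × Bool := fun B => (cutEdges T B, decide (v ∈ B))
  have hinj : Set.InjOn g (properSets V) := by
    intro B _ B' _ h
    simp only [g, Prod.mk.injEq, decide_eq_decide] at h
    exact eq_of_cutEdges_eq hT h.1 v h.2
  have himage : (properSets V).image g ⊆
      (T.edgeFinset.powerset.erase ∅) ×ˢ (Finset.univ : Finset Bool) := by
    intro p hp
    obtain ⟨B, hB, rfl⟩ := Finset.mem_image.1 hp
    rw [mem_properSets] at hB
    simp only [g, Finset.mem_product, Finset.mem_erase, Finset.mem_powerset, Finset.mem_univ,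
      and_true]
    exact ⟨(cutEdges_nonempty hT hB.1 hB.2).ne_empty, Finset.filter_subset _ _⟩
  have hsum : ∑ F ∈ T.edgeFinset.powerset.erase ∅, x ^ F.card
      = (1 + x) ^ T.edgeFinset.card - 1 := by
    have h := Finset.sum_pow_mul_eq_add_pow x 1 T.edgeFinset
    simp only [one_pow, mul_one] at h
    rw [← Finset.add_sum_erase _ _ (Finset.empty_mem_powerset _)] at h
    simp only [Finset.card_empty, pow_zero] at h
    rw [add_comm 1 x]
    linarith
  calc ∑ B ∈ properSets V, x ^ (cutEdges T B).card
      = ∑ p ∈ (properSets V).image g, x ^ p.1.card := by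
        rw [Finset.sum_image hinj]
    _ ≤ ∑ p ∈ (T.edgeFinset.powerset.erase ∅) ×ˢ (Finset.univ : Finset Bool), x ^ p.1.card :=
        Finset.sum_le_sum_of_subset_of_nonneg himage fun _ _ _ => by positivity
    _ = 2 * ((1 + x) ^ T.edgeFinset.card - 1) := by
        rw [Finset.sum_product, ← hsum, Finset.mul_sum]
        simp

/-- The spanning trees of `G`. -/
def spanningTrees (G : SimpleGraph V) : Finset (SimpleGraph V) :=
  (Set.toFinite {T : SimpleGraph V | T ≤ G ∧ T.IsTree}).toFinset

theorem mem_spanningTrees {G T : SimpleGraph V} : T ∈ spanningTrees G ↔ T ≤ G ∧ T.IsTree := by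
  simp [spanningTrees]

theorem spanningTrees_nonempty {G : SimpleGraph V} (hG : G.Connected) :
    (spanningTrees G).Nonempty := by
  obtain ⟨T, hT⟩ := hG.exists_isTree_le
  exact ⟨T, mem_spanningTrees.2 hT⟩

open Classical in
theorem effectiveResistance_eq (G : SimpleGraph V) (e : Sym2 V) :
    effectiveResistance G e =
      (∑ T ∈ spanningTrees G, if e ∈ T.edgeSet then (1 : ℝ) else 0) / (spanningTrees G).card := by
  unfold effectiveResistance
  congr 2
  · rw [Finset.sum_boole, ← Set.ncard_coe_finset]
    congr 2
    ext T
    simp [mem_spanningTrees, and_assoc]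
  · rw [← Set.ncard_coe_finset]
    congr 1
    ext T
    simp [mem_spanningTrees]

open Classical in
/-- The total effective resistance of a set of edges is the expected number of these edges in a
uniform spanning tree. -/
theorem sum_effectiveResistance (G : SimpleGraph V) (D : Finset (Sym2 V)) :
    ∑ e ∈ D, effectiveResistance G e =
      ∑ T ∈ spanningTrees G,
        ((spanningTrees G).card : ℝ)⁻¹ * ((D.filter (· ∈ T.edgeSet)).card : ℝ) := by
  simp_rw [effectiveResistance_eq, div_eq_inv_mul]
  rw [← Finset.mul_sum, Finset.sum_comm, ← Finset.mul_sum]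
  simp

open Classical in
/-- **Foster's theorem**: the effective resistances of the edges sum to `|V| - 1`. -/
theorem sum_effectiveResistance_edgeFinset {G : SimpleGraph V} (hG : G.Connected) :
    ∑ e ∈ G.edgeFinset, effectiveResistance G e = (Fintype.card V : ℝ) - 1 := by
  rw [sum_effectiveResistance]
  have hpos : ((spanningTrees G).card : ℝ) ≠ 0 := by
    exact_mod_cast (spanningTrees_nonempty hG).card_pos.ne'
  have h : ∀ T ∈ spanningTrees G,
      ((spanningTrees G).card : ℝ)⁻¹ * ((G.edgeFinset.filter (· ∈ T.edgeSet)).card : ℝ)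
        = ((spanningTrees G).card : ℝ)⁻¹ * ((Fintype.card V : ℝ) - 1) := by
    intro T hT
    rw [mem_spanningTrees] at hT
    have heq : G.edgeFinset.filter (· ∈ T.edgeSet) = T.edgeFinset := by
      ext e
      simp only [Finset.mem_filter, SimpleGraph.mem_edgeFinset, and_iff_right_iff_imp]
      exact fun he => SimpleGraph.edgeSet_mono hT.1 he
    rw [heq, ← hT.2.card_edgeFinset]
    push_cast
    ring
  rw [Finset.sum_congr rfl h, Finset.sum_const, nsmul_eq_mul]
  field_simp

theorem sum_cutEdges_effectiveResistance (G : SimpleGraph V) (B : Finset V) :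
    ∑ e ∈ cutEdges G B, effectiveResistance G e =
      ∑ T ∈ spanningTrees G,
        ((spanningTrees G).card : ℝ)⁻¹ * ((cutEdges T B).card : ℝ) := by
  classical
  rw [sum_effectiveResistance]
  refine Finset.sum_congr rfl fun T hT => ?_
  congr 3
  rw [mem_spanningTrees] at hT
  ext e
  induction e with
  | _ i j =>
    simp only [Finset.mem_filter, mk_mem_cutEdges, SimpleGraph.mem_edgeSet]
    have := hT.1 (v := i) (w := j)
    tauto

/-- Every spanning tree crosses a proper cut at least once, hence so does the average tree. -/
theorem one_le_sum_cutEdges_effectiveResistance {G : SimpleGraph V} (hG : G.Connected)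
    {B : Finset V} (hB : B ∈ properSets V) : 1 ≤ ∑ e ∈ cutEdges G B, effectiveResistance G e := by
  rw [mem_properSets] at hB
  have hpos : (0 : ℝ) < (spanningTrees G).card :=
    Nat.cast_pos.2 (spanningTrees_nonempty hG).card_pos
  rw [sum_cutEdges_effectiveResistance, ← Finset.mul_sum, le_inv_mul_iff₀ hpos, mul_one,
    Finset.card_eq_sum_ones, Nat.cast_sum]
  refine Finset.sum_le_sum fun T hT => Nat.cast_le.2 ?_
  exact (cutEdges_nonempty (mem_spanningTrees.1 hT).2.connected hB.1 hB.2).card_pos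

/-- Cut counting by spanning trees: the sum of `x ^ r(∂B)` over all cuts, where `r` is
the effective resistance. -/
theorem sum_rpow_effectiveResistance_le {G : SimpleGraph V} (hG : G.Connected) {x : ℝ}
    (hx : 0 < x) :
    ∑ B ∈ properSets V, x ^ (∑ e ∈ cutEdges G B, effectiveResistance G e)
      ≤ 2 * ((1 + x) ^ (Fintype.card V - 1) - 1) := by
  classical
  set N : ℝ := ((spanningTrees G).card : ℝ) with hN
  have hpos : 0 < N := Nat.cast_pos.2 (spanningTrees_nonempty hG).card_pos
  have hsum : ∑ _T ∈ spanningTrees G, N⁻¹ = 1 := by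
    rw [Finset.sum_const, nsmul_eq_mul, ← hN, mul_inv_cancel₀ hpos.ne']
  calc ∑ B ∈ properSets V, x ^ (∑ e ∈ cutEdges G B, effectiveResistance G e)
      ≤ ∑ B ∈ properSets V, ∑ T ∈ spanningTrees G, N⁻¹ * x ^ (cutEdges T B).card := by
        refine Finset.sum_le_sum fun B _ => ?_
        rw [sum_cutEdges_effectiveResistance, ← hN, Real.rpow_sum_of_pos hx]
        -- Jensen for `k ↦ x ^ k` under the uniform spanning tree, in the form of weighted AM-GM.
        have := Real.geom_mean_le_arith_mean_weighted (spanningTrees G) (fun _ => N⁻¹)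
          (fun T => x ^ (cutEdges T B).card) (fun _ _ => by positivity) hsum
          (fun _ _ => by positivity)
        refine le_trans (le_of_eq ?_) this
        refine Finset.prod_congr rfl fun T _ => ?_
        rw [mul_comm, Real.rpow_mul hx.le, Real.rpow_natCast]
    _ = ∑ T ∈ spanningTrees G, N⁻¹ * ∑ B ∈ properSets V, x ^ (cutEdges T B).card := by
        rw [Finset.sum_comm]
        simp_rw [Finset.mul_sum]
    _ ≤ ∑ T ∈ spanningTrees G, N⁻¹ * (2 * ((1 + x) ^ (Fintype.card V - 1) - 1)) := by
        refine Finset.sum_le_sum fun T hT => ?_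
        rw [mem_spanningTrees] at hT
        have h := sum_pow_card_cutEdges_le hT.2.connected hx.le
        rw [show T.edgeFinset.card = Fintype.card V - 1 by
          rw [← hT.2.card_edgeFinset, Nat.add_sub_cancel]] at h
        gcongr
    _ = 2 * ((1 + x) ^ (Fintype.card V - 1) - 1) := by
        rw [← Finset.sum_mul, hsum, one_mul]

theorem card_sub_one_le_totalWeight {G : SimpleGraph V} (hG : G.Connected) {w : Sym2 V → ℝ}
    (hw : ∀ e ∈ G.edgeSet, effectiveResistance G e ≤ w e) :
    (Fintype.card V : ℝ) - 1 ≤ totalWeight G w := by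
  classical
  rw [← sum_effectiveResistance_edgeFinset hG]
  unfold totalWeight
  exact Finset.sum_le_sum fun e he => hw e (by simpa using he)

theorem sum_cutEdges_effectiveResistance_le {G : SimpleGraph V} {w : Sym2 V → ℝ}
    (hw : ∀ e ∈ G.edgeSet, effectiveResistance G e ≤ w e) (B : Finset V) :
    ∑ e ∈ cutEdges G B, effectiveResistance G e ≤ ∑ e ∈ cutEdges G B, w e := by
  refine Finset.sum_le_sum fun e he => hw e ?_
  simp only [cutEdges, Finset.mem_filter, SimpleGraph.mem_edgeFinset] at he
  exact he.1

end Cuts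

/-! ### Two-valued vectors and the output of the algorithm -/

section Algorithm

/-- Constancy of the stored vector is a loop invariant: since `0 ≤ τ`, a proposal passing the test
does not exceed `F μ₀` and is therefore constant. -/
theorem foldl_loopStep_const {V : Type*} {F : (V → ℝ) → ℝ} {τ : ℝ} (hτ : 0 ≤ τ) {μ₀ : V → ℝ}
    (L : List (V → ℝ)) (hL : ∀ v ∈ L, F v ≤ F μ₀ → ∀ i j, v i = v j) (st : (V → ℝ) × Bool)
    (hst : ∀ i j, st.1 i = st.1 j) (i j : V) :
    (L.foldl (loopStep F τ μ₀) st).1 i = (L.foldl (loopStep F τ μ₀) st).1 j := by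
  induction L generalizing st with
  | nil => exact hst i j
  | cons v L ih =>
    rw [List.foldl_cons]
    refine ih (fun u hu => hL u (List.mem_cons_of_mem _ hu)) _ fun k l => ?_
    unfold loopStep
    split_ifs with h1 h2
    · exact hL v List.mem_cons_self (by linarith) k l
    · exact hst k l
    · exact hst k l

variable {V : Type*} [Fintype V]

/-- For every cut, the penalty exceeds the gain in fit from a two-valued vector. -/
def CutsDominate (G : SimpleGraph V) (Y : V → ℝ) (lam : ℝ) (w : Sym2 V → ℝ) : Prop :=
  ∀ B ∈ properSets V, (∑ i ∈ B, (Y i - meanVector Y i)) ^ 2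
    < 2 * lam * B.card * ∑ e ∈ cutEdges G B, w e

open Classical in
theorem objective_twoValued (G : SimpleGraph V) (Y : V → ℝ) (lam : ℝ) (w : Sym2 V → ℝ)
    {c m : ℝ} (hcm : c ≠ m) (B : Finset V) :
    objective G Y lam w (fun i => if i ∈ B then c else m) =
      (1 / 2) * (∑ i, (Y i - m) ^ 2 + B.card * (c - m) ^ 2 - 2 * (c - m) * ∑ i ∈ B, (Y i - m))
        + lam * ∑ e ∈ cutEdges G B, w e := by
  unfold objective
  congr 2
  · have h : ∀ i, (Y i - if i ∈ B then c else m) ^ 2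
        = (Y i - m) ^ 2 + if i ∈ B then (c - m) ^ 2 - 2 * (c - m) * (Y i - m) else 0 := by
      intro i
      split_ifs <;> ring
    have hB : ∑ i ∈ B, ((c - m) ^ 2 - 2 * (c - m) * (Y i - m))
        = B.card * (c - m) ^ 2 - 2 * (c - m) * ∑ i ∈ B, (Y i - m) := by
      rw [Finset.sum_sub_distrib, Finset.sum_const, nsmul_eq_mul, Finset.mul_sum]
    rw [Finset.sum_congr rfl fun i _ => h i, Finset.sum_add_distrib, Finset.sum_ite_mem,
      Finset.univ_inter, hB]
    ring
  · unfold cutEdges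
    rw [Finset.sum_filter]
    refine Finset.sum_congr rfl fun e _ => ?_
    induction e with
    | _ i j =>
      by_cases hi : i ∈ B <;> by_cases hj : j ∈ B <;> simp [hi, hj, hcm, hcm.symm]

theorem objective_const (G : SimpleGraph V) (Y : V → ℝ) (lam : ℝ) (w : Sym2 V → ℝ) (m : ℝ) :
    objective G Y lam w (fun _ => m) = (1 / 2) * ∑ i, (Y i - m) ^ 2 := by
  unfold objective
  simp only [add_eq_left]
  rw [Finset.sum_eq_zero, mul_zero]
  intro e _
  induction e with
  | _ i j => simp

/-- An expansion of the mean vector that does not increase the objective is constant. -/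
theorem IsAlphaExpansion.eq_of_objective_le {G : SimpleGraph V} {Y : V → ℝ} {lam : ℝ}
    {w : Sym2 V → ℝ} (hdom : CutsDominate G Y lam w) {c : ℝ} {μ' : V → ℝ}
    (h : IsAlphaExpansion G Y lam w c (meanVector Y) μ')
    (hle : objective G Y lam w μ' ≤ objective G Y lam w (meanVector Y)) (i j : V) :
    μ' i = μ' j := by
  classical
  obtain ⟨S, -, hS⟩ := h
  set m : ℝ := (∑ i, Y i) / (Fintype.card V : ℝ) with hm
  have hmean : meanVector Y = fun _ => m := rfl
  rw [hmean] at hS hle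
  by_cases hcm : c = m
  · simp [hS, hcm]
  set B : Finset V := Finset.univ.filter fun i => CutVertex.node i ∉ S with hB
  have hμ' : μ' = fun i => if i ∈ B then c else m := by
    ext k
    rw [hS k]
    by_cases hk : CutVertex.node k ∈ S <;> simp [hB, hk]
  by_cases hprop : B ∈ properSets V
  · exfalso
    have hdomB := hdom B hprop
    rw [hmean] at hdomB
    rw [hμ', objective_twoValued G Y lam w hcm B, objective_const] at hle
    set X := ∑ i ∈ B, (Y i - m)
    set b := ∑ e ∈ cutEdges G B, w e
    have hcard : (0 : ℝ) < B.card := by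
      exact_mod_cast (mem_properSets.1 hprop).1.card_pos
    have hmul : (B.card : ℝ) * (B.card * (c - m) ^ 2 - 2 * (c - m) * X + 2 * (lam * b)) ≤ 0 :=
      mul_nonpos_of_nonneg_of_nonpos hcard.le (by linarith)
    -- Completing the square: the left side of `hmul` is `(|B| (c - m) - X)² - X² + 2 λ |B| b`,
    -- which `hdomB` makes positive.
    nlinarith [sq_nonneg (B.card * (c - m) - X)]
  · rw [mem_properSets, not_and_or, Finset.not_nonempty_iff_eq_empty, not_not] at hprop
    rw [hμ']
    rcases hprop with h0 | h0 <;> simp [h0]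

theorem IsPottsOutput.const {G : SimpleGraph V} {Y : V → ℝ} {δ τ lam : ℝ} {w : Sym2 V → ℝ}
    (hdom : CutsDominate G Y lam w) (hτ : 0 ≤ τ) {out : V → ℝ}
    (h : IsPottsOutput G Y δ τ lam w out) (i j : V) : out i = out j := by
  obtain ⟨l, prop, -, -, hexp, hout⟩ := h
  simp only at hout
  rw [hout]
  split_ifs
  · refine foldl_loopStep_const hτ _ ?_ _ (fun _ _ => rfl) i j
    intro v hv hle
    obtain ⟨c, hc, rfl⟩ := List.mem_map.1 hv
    exact (hexp c hc).eq_of_objective_le hdom hle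
  · rfl

theorem card_inducedPartition_of_const [DecidableEq V] [Nonempty V] {v : V → ℝ}
    (h : ∀ i j, v i = v j) : (inducedPartition v).parts.card = 1 := by
  have hne : (Finset.univ : Finset V) ≠ ⊥ := by
    simpa using (Finset.univ_nonempty (α := V)).ne_empty
  apply le_antisymm
  · refine ((inducedPartition_isLeast v).2 (Finpartition.indiscrete hne)
      fun _ _ i _ j _ => h i j).trans ?_
    simp [Finpartition.indiscrete]
  · rw [Nat.one_le_iff_ne_zero, Finset.card_ne_zero]
    exact (inducedPartition v).parts_nonempty hne

end Algorithm

/-! ### Probability bounds -/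

section Probability

variable {V Ω : Type*} [Fintype V] [MeasurableSpace Ω] {P : Measure Ω}

theorem hasSubgaussianMGF_mono {X : Ω → ℝ} {a b : ℝ≥0} (h : HasSubgaussianMGF X a P)
    (hab : a ≤ b) : HasSubgaussianMGF X b P where
  integrable_exp_mul := h.integrable_exp_mul
  mgf_le t := (h.mgf_le t).trans (by gcongr)

/-- Deviations from the sample mean, summed over a set `B`, are sub-Gaussian with variance proxy
`|B|` times that of the noise. -/
theorem hasSubgaussianMGF_sum_sub_mean {ε : V → Ω → ℝ} {v : ℝ≥0} (hindep : iIndepFun ε P)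
    (hsub : ∀ i, HasSubgaussianMGF (ε i) v P) (B : Finset V) :
    HasSubgaussianMGF (fun ω => ∑ i ∈ B, (ε i ω - (∑ k, ε k ω) / (Fintype.card V : ℝ)))
      (B.card * v) P := by
  classical
  set n : ℝ := (Fintype.card V : ℝ) with hn
  -- Coefficient of `ε i` in the centred sum. The squares add up to `|B| - |B|² / n ≤ |B|`.
  let a : V → ℝ := fun i => (if i ∈ B then 1 else 0) - B.card / n
  have hind' : iIndepFun (fun i ω => a i * ε i ω) P :=
    hindep.comp (fun i x => a i * x) fun i => measurable_const_mul (a i)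
  have hsub' : ∀ i, HasSubgaussianMGF (fun ω => a i * ε i ω) ((a i ^ 2).toNNReal * v) P := by
    intro i
    rw [Real.toNNReal_of_nonneg (sq_nonneg _)]
    exact (hsub i).const_mul (a i)
  have hsum := HasSubgaussianMGF.sum_of_iIndepFun hind' (s := Finset.univ) fun i _ => hsub' i
  have hfun : (fun ω => ∑ i ∈ B, (ε i ω - (∑ k, ε k ω) / n))
      = fun ω => ∑ i, a i * ε i ω := by
    ext ω
    simp only [a, sub_mul, ite_mul, one_mul, zero_mul, Finset.sum_sub_distrib, Finset.sum_ite_mem,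
      Finset.univ_inter, Finset.sum_const, nsmul_eq_mul, ← Finset.mul_sum]
    ring
  rw [hfun]
  refine hasSubgaussianMGF_mono hsum ?_
  rw [← Finset.sum_mul]
  gcongr
  rw [← NNReal.coe_le_coe]
  have hsq : ∀ i, a i ^ 2 = (if i ∈ B then 1 - 2 * (B.card / n) else 0) + (B.card / n) ^ 2 := by
    intro i
    simp only [a]
    split_ifs <;> ring
  rw [NNReal.coe_sum, NNReal.coe_natCast]
  simp_rw [Real.coe_toNNReal _ (sq_nonneg _), hsq, Finset.sum_add_distrib, Finset.sum_ite_mem, Finset.univ_inter, Finset.sum_const,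
    nsmul_eq_mul, Finset.card_univ, ← hn]
  rcases eq_or_ne n 0 with h0 | h0
  · simp [h0]
  · have hnpos : 0 < n := lt_of_le_of_ne (by positivity) h0.symm
    have : (B.card : ℝ) * (1 - 2 * (B.card / n)) + n * (B.card / n) ^ 2
        = B.card - B.card ^ 2 / n := by
      field_simp
      ring
    rw [this]
    have : 0 ≤ (B.card : ℝ) ^ 2 / n := by positivity
    linarith

variable [IsProbabilityMeasure P]

theorem measureReal_sq_ge_le {X : Ω → ℝ} {v : ℝ≥0} (h : HasSubgaussianMGF X v P) {s : ℝ}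
    (hs : 0 ≤ s) : P.real {ω | s ≤ X ω ^ 2} ≤ 2 * Real.exp (-s / (2 * v)) := by
  have h1 := h.measure_ge_le (Real.sqrt_nonneg s)
  have h2 := h.neg.measure_ge_le (Real.sqrt_nonneg s)
  rw [Real.sq_sqrt hs] at h1 h2
  have hsub : {ω | s ≤ X ω ^ 2} ⊆ {ω | √s ≤ X ω} ∪ {ω | √s ≤ (-X) ω} := by
    intro ω hω
    simp only [Set.mem_ofPred_eq] at hω
    have := Real.sqrt_le_sqrt hω
    rw [Real.sqrt_sq_eq_abs] at this
    simpa [le_abs] using this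
  calc P.real {ω | s ≤ X ω ^ 2}
      ≤ P.real ({ω | √s ≤ X ω} ∪ {ω | √s ≤ (-X) ω}) := measureReal_mono hsub
    _ ≤ _ := measureReal_union_le _ _
    _ ≤ _ := by linarith

theorem meanVector_add_const [Nonempty V] (m : ℝ) (y : V → ℝ) (i : V) :
    meanVector (fun k => m + y k) i = m + (∑ k, y k) / (Fintype.card V : ℝ) := by
  have : (Fintype.card V : ℝ) ≠ 0 := by simp
  simp only [meanVector, Finset.sum_add_distrib, Finset.sum_const, Finset.card_univ,
    nsmul_eq_mul]
  field_simp

/-- Centring removes the common mean, so the event can be stated for the noise alone. -/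
theorem cutsDominate_add_const_iff [Nonempty V] (G : SimpleGraph V) (m : ℝ) (y : V → ℝ) (lam : ℝ)
    (w : Sym2 V → ℝ) : CutsDominate G (fun k => m + y k) lam w ↔ CutsDominate G y lam w := by
  unfold CutsDominate
  simp_rw [meanVector_add_const, add_sub_add_left_eq_sub]
  rfl

theorem measurableSet_cutsDominate (G : SimpleGraph V) {y : V → Ω → ℝ}
    (hy : ∀ i, Measurable (y i)) (lam : ℝ) (w : Sym2 V → ℝ) :
    MeasurableSet {ω | CutsDominate G (fun i => y i ω) lam w} := by
  unfold CutsDominate meanVector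
  simp only [Set.ofPred_forall]
  refine MeasurableSet.iInter fun B => MeasurableSet.iInter fun _ => ?_
  exact measurableSet_lt (by fun_prop) measurable_const

/-- Union bound over all cuts. -/
theorem measureReal_not_cutsDominate_le {G : SimpleGraph V} (hG : G.Connected) {ε : V → Ω → ℝ}
    {σ : ℝ≥0} (hσ : 0 < σ) (hindep : iIndepFun ε P)
    (hsub : ∀ i, HasSubgaussianMGF (ε i) (σ ^ 2) P) {w : Sym2 V → ℝ}
    (hw : ∀ e ∈ G.edgeSet, effectiveResistance G e ≤ w e) {lam : ℝ} (hlam : 0 ≤ lam) :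
    P.real {ω | ¬ CutsDominate G (fun i => ε i ω) lam w}
      ≤ 4 * ((1 + Real.exp (-lam / (σ : ℝ) ^ 2)) ^ (Fintype.card V - 1) - 1) := by
  have hset : {ω | ¬ CutsDominate G (fun i => ε i ω) lam w} =
      ⋃ B ∈ properSets V, {ω | 2 * lam * B.card * ∑ e ∈ cutEdges G B, w e
        ≤ (∑ i ∈ B, (ε i ω - (∑ k, ε k ω) / (Fintype.card V : ℝ))) ^ 2} := by
    ext ω
    simp only [CutsDominate, meanVector, Set.mem_ofPred_eq, Set.mem_iUnion, not_forall, not_lt,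
      exists_prop]
  rw [hset]
  have hσ' : (0 : ℝ) < σ := hσ
  have hr : ∀ B : Finset V, 0 ≤ ∑ e ∈ cutEdges G B, effectiveResistance G e := fun B =>
    Finset.sum_nonneg fun e _ => by unfold effectiveResistance; positivity
  calc _ ≤ ∑ B ∈ properSets V, P.real {ω | 2 * lam * B.card * ∑ e ∈ cutEdges G B, w e
        ≤ (∑ i ∈ B, (ε i ω - (∑ k, ε k ω) / (Fintype.card V : ℝ))) ^ 2} :=
        measureReal_biUnion_finset_le _ _
    _ ≤ ∑ B ∈ properSets V, 2 * Real.exp (-lam / (σ : ℝ) ^ 2) ^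
          (∑ e ∈ cutEdges G B, effectiveResistance G e) := by
        refine Finset.sum_le_sum fun B hB => ?_
        have hrw := sum_cutEdges_effectiveResistance_le hw B
        have hcard : (0 : ℝ) < B.card := Nat.cast_pos.2 (mem_properSets.1 hB).1.card_pos
        have h0 : 0 ≤ ∑ e ∈ cutEdges G B, w e := (hr B).trans hrw
        refine (measureReal_sq_ge_le (hasSubgaussianMGF_sum_sub_mean hindep hsub B)
          (by positivity)).trans ?_
        rw [← Real.exp_mul]
        gcongr
        push_cast
        -- The factor `|B|` in the threshold cancels the `|B|` in the variance proxy, leaving an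
        -- exponent that depends only on the weight of the cut.
        have : -(2 * lam * B.card * ∑ e ∈ cutEdges G B, w e) / (2 * (B.card * (σ : ℝ) ^ 2))
            = -(lam / (σ : ℝ) ^ 2 * ∑ e ∈ cutEdges G B, w e) := by
          field_simp
        rw [this, neg_div, neg_mul]
        gcongr
    _ = 2 * ∑ B ∈ properSets V, Real.exp (-lam / (σ : ℝ) ^ 2) ^
          (∑ e ∈ cutEdges G B, effectiveResistance G e) := by rw [Finset.mul_sum]
    _ ≤ 2 * (2 * ((1 + Real.exp (-lam / (σ : ℝ) ^ 2)) ^ (Fintype.card V - 1) - 1)) := by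
        gcongr
        exact sum_rpow_effectiveResistance_le hG (Real.exp_pos _)
    _ = _ := by ring

/-- Two independent copies of a sub-Gaussian variable are close with non-negligible
probability, however small the required distance is. -/
theorem le_measureReal_abs_sub_lt {X X' : Ω → ℝ} {σ : ℝ≥0} (hσ : 0 < σ) (hX : Measurable X)
    (hindep : IndepFun X X' P) (hid : IdentDistrib X X' P P)
    (hsub : HasSubgaussianMGF X (σ ^ 2) P) {x : ℝ} (hx : 0 < x) (hx3 : x ≤ 3) :
    x ^ 2 / 196 ≤ P.real {ω | |X ω - X' ω| < σ * x} := by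
  have hσ' : (0 : ℝ) < σ := hσ
  -- Cut `[-2σ, 2σ)` into `N` cells of length at most `σ x`. By the tail bound `2 exp (-2) ≤ 1/2`,
  -- this interval carries at least half the mass, so some cell has mass at least `1 / (2N)`. Both
  -- copies fall into it with at least the square of that probability.
  set N : ℕ := ⌈4 / x⌉₊ with hN
  have hNpos : 0 < N := Nat.ceil_pos.2 (by positivity)
  have hNpos' : (0 : ℝ) < N := Nat.cast_pos.2 hNpos
  have hN1 : 4 / x ≤ N := Nat.le_ceil _
  have hN2 : (N : ℝ) < 4 / x + 1 := Nat.ceil_lt_add_one (by positivity)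
  set h : ℝ := 4 * σ / N with hh
  have hhpos : 0 < h := by positivity
  have hhx : h ≤ σ * x := by
    rw [hh, div_le_iff₀ hNpos']
    rw [div_le_iff₀ hx] at hN1
    nlinarith
  let I : ℕ → Set ℝ := fun k => Set.Ico (-2 * σ + k * h) (-2 * σ + (k + 1) * h)
  have hImeas : ∀ k, MeasurableSet (I k) := fun k => measurableSet_Ico
  have hbulk : (1 : ℝ) / 2 ≤ P.real {ω | X ω ^ 2 < 4 * (σ : ℝ) ^ 2} := by
    have htail := measureReal_sq_ge_le hsub (s := 4 * (σ : ℝ) ^ 2) (by positivity)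
    have hexp : -(4 * (σ : ℝ) ^ 2) / (2 * ((σ ^ 2 : ℝ≥0) : ℝ)) = -2 := by
      push_cast
      field_simp
      norm_num
    rw [hexp, Real.exp_neg] at htail
    have he : (4 : ℝ) ≤ Real.exp 2 := by
      have h1 := Real.add_one_le_exp (1 : ℝ)
      have h2 : Real.exp 2 = Real.exp 1 * Real.exp 1 := by rw [← Real.exp_add]; norm_num
      nlinarith
    have hinv : (Real.exp 2)⁻¹ ≤ 4⁻¹ := inv_anti₀ (by norm_num) he
    have hcompl := probReal_compl_eq_one_sub (μ := P)
      (measurableSet_le measurable_const (hX.pow_const 2) :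
        MeasurableSet {ω | 4 * (σ : ℝ) ^ 2 ≤ X ω ^ 2})
    have : {ω | 4 * (σ : ℝ) ^ 2 ≤ X ω ^ 2}ᶜ = {ω | X ω ^ 2 < 4 * (σ : ℝ) ^ 2} := by
      ext ω; simp
    rw [this] at hcompl
    linarith
  have hcover : {ω | X ω ^ 2 < 4 * (σ : ℝ) ^ 2} ⊆ ⋃ k ∈ Finset.range N, X ⁻¹' I k := by
    intro ω hω
    simp only [Set.mem_ofPred_eq] at hω
    have habs : |X ω| < 2 * σ := abs_lt_of_sq_lt_sq (by linarith) (by positivity)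
    rw [abs_lt] at habs
    have hy : 0 ≤ (X ω + 2 * σ) / h := div_nonneg (by linarith) hhpos.le
    simp only [Set.mem_iUnion, Finset.mem_range, Set.mem_preimage, exists_prop]
    refine ⟨⌊(X ω + 2 * σ) / h⌋₊, ?_, ?_, ?_⟩
    · rw [Nat.floor_lt hy, div_lt_iff₀ hhpos, hh]
      field_simp
      linarith
    · have := Nat.floor_le hy
      rw [le_div_iff₀ hhpos] at this
      linarith
    · have := Nat.lt_floor_add_one ((X ω + 2 * σ) / h)
      rw [div_lt_iff₀ hhpos] at this
      linarith
  obtain ⟨k, -, hk⟩ : ∃ k ∈ Finset.range N, 1 / (2 * (N : ℝ)) ≤ P.real (X ⁻¹' I k) := by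
    refine Finset.exists_le_of_sum_le (Finset.nonempty_range_iff.2 hNpos.ne') ?_
    calc ∑ _k ∈ Finset.range N, 1 / (2 * (N : ℝ)) = 1 / 2 := by
          rw [Finset.sum_const, Finset.card_range, nsmul_eq_mul]
          field_simp
      _ ≤ _ := hbulk
      _ ≤ _ := measureReal_mono hcover (measure_ne_top _ _)
      _ ≤ _ := measureReal_biUnion_finset_le _ _
  have hprod : P.real (X ⁻¹' I k ∩ X' ⁻¹' I k) = P.real (X ⁻¹' I k) * P.real (X ⁻¹' I k) := by
    have h1 := hindep.measure_inter_preimage_eq_mul _ _ (hImeas k) (hImeas k)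
    rw [← hid.measure_mem_eq (hImeas k)] at h1
    simp only [measureReal_def, h1, ENNReal.toReal_mul]
  calc x ^ 2 / 196 ≤ (1 / (2 * (N : ℝ))) * (1 / (2 * (N : ℝ))) := by
        -- `N x ≤ 4 + x ≤ 7`, hence `1 / (2N) ≥ x / 14`, and `196 = 14²`.
        have hNx : (N : ℝ) * x ≤ 7 := by
          have : (4 / x + 1) * x = 4 + x := by field_simp
          nlinarith
        have h7 : x / 14 ≤ 1 / (2 * (N : ℝ)) := by
          rw [div_le_div_iff₀ (by norm_num) (by positivity)]
          linarith
        calc x ^ 2 / 196 = (x / 14) * (x / 14) := by ring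
          _ ≤ _ := by gcongr
    _ ≤ P.real (X ⁻¹' I k) * P.real (X ⁻¹' I k) := by gcongr
    _ = P.real (X ⁻¹' I k ∩ X' ⁻¹' I k) := hprod.symm
    _ ≤ P.real {ω | |X ω - X' ω| < σ * x} := by
        refine measureReal_mono ?_
        rintro ω ⟨⟨h1, h2⟩, h3, h4⟩
        rw [Set.mem_ofPred_eq, abs_lt]
        constructor <;> linarith

end Probability

/-! ### The event on which all cuts are dominated -/

section Main

variable {Ω : Type*} [MeasurableSpace Ω] {P : Measure Ω} [IsProbabilityMeasure P]

theorem le_measureReal_cutsDominate_of_two_le {V : Type*} [Fintype V] {G : SimpleGraph V}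
    (hG : G.Connected) {ε : V → Ω → ℝ} {σ : ℝ≥0} (hσ : 0 < σ) (hmeas : ∀ i, Measurable (ε i))
    (hindep : iIndepFun ε P) (hsub : ∀ i, HasSubgaussianMGF (ε i) (σ ^ 2) P) {w : Sym2 V → ℝ}
    (hw : ∀ e ∈ G.edgeSet, effectiveResistance G e ≤ w e) {C : ℝ} (hC : 5 ≤ C)
    (hW : 2 ≤ totalWeight G w) :
    1 - (totalWeight G w) ^ (-(1 : ℝ)) ≤ P.real {ω | CutsDominate G (fun i => ε i ω)
      (C * (σ : ℝ) ^ 2 * Real.log (totalWeight G w)) w} := by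
  set W := totalWeight G w with hWdef
  have hWpos : 0 < W := by linarith
  have hσ' : (0 : ℝ) < σ := hσ
  have hlog : 0 ≤ Real.log W := Real.log_nonneg (by linarith)
  have hfail := measureReal_not_cutsDominate_le hG hσ hindep hsub hw
    (lam := C * (σ : ℝ) ^ 2 * Real.log W) (by positivity)
  have hx : Real.exp (-(C * (σ : ℝ) ^ 2 * Real.log W) / (σ : ℝ) ^ 2) = W ^ (-C) := by
    rw [Real.rpow_def_of_pos hWpos]
    congr 1
    field_simp
  rw [hx] at hfail
  set x := W ^ (-C) with hxdef
  have hxpos : 0 < x := Real.rpow_pos_of_pos hWpos _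
  have hx5 : x ≤ (W ^ 5)⁻¹ := by
    calc x ≤ W ^ (-(5 : ℝ)) := Real.rpow_le_rpow_of_exponent_le (by linarith) (by linarith)
      _ = (W ^ 5)⁻¹ := by rw [Real.rpow_neg hWpos.le]; norm_cast
  -- The failure bound will be `4 (exp (W x) - 1) ≤ 8 W x`. Exponent 5 leaves a spare `W³ ≥ 8` to
  -- absorb the 8.
  have hWx : 8 * (W * x) ≤ W⁻¹ := by
    have h8 : 8 ≤ W ^ 3 := by
      calc (8 : ℝ) = 2 ^ 3 := by norm_num
        _ ≤ W ^ 3 := by gcongr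
    calc 8 * (W * x) ≤ W ^ 3 * (W * (W ^ 5)⁻¹) := by gcongr
      _ = W⁻¹ := by field_simp
  have hWinv : W⁻¹ ≤ 1 := inv_le_one_of_one_le₀ (by linarith)
  have hpow : (1 + x) ^ (Fintype.card V - 1) ≤ Real.exp (W * x) := by
    have hn : ((Fintype.card V - 1 : ℕ) : ℝ) ≤ W := by
      have : 0 < Fintype.card V := Fintype.card_pos_iff.2 hG.nonempty
      rw [Nat.cast_sub this, Nat.cast_one]
      exact card_sub_one_le_totalWeight hG hw
    calc (1 + x) ^ (Fintype.card V - 1) ≤ Real.exp x ^ (Fintype.card V - 1) := by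
          gcongr
          linarith [Real.add_one_le_exp x]
      _ = Real.exp ((Fintype.card V - 1 : ℕ) * x) := (Real.exp_nat_mul _ _).symm
      _ ≤ Real.exp (W * x) := by gcongr
  have hexp := Real.abs_exp_sub_one_le (x := W * x) (by
    rw [abs_of_pos (by positivity)]
    linarith)
  rw [abs_of_pos (show 0 < W * x by positivity)] at hexp
  have hexp' := (le_abs_self _).trans hexp
  have hcompl := probReal_compl_eq_one_sub (μ := P)
    (measurableSet_cutsDominate G hmeas (C * (σ : ℝ) ^ 2 * Real.log W) w)
  rw [Set.compl_ofPred] at hcompl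
  rw [Real.rpow_neg_one]
  linarith

/-- Here `X_B² = (ε 0 - ε 1)² / 4` for both proper sets, and the cut weighs at least 1. So it
suffices that `(ε 0 - ε 1)² < 8 σ² L`. -/
theorem le_measureReal_cutsDominate_fin_two {G : SimpleGraph (Fin 2)}
    (hG : G.Connected) {ε : Fin 2 → Ω → ℝ} {σ : ℝ≥0} (hσ : 0 < σ)
    (hmeas : ∀ i, Measurable (ε i)) (hindep : iIndepFun ε P)
    (hid : IdentDistrib (ε 0) (ε 1) P P) (hsub : HasSubgaussianMGF (ε 0) (σ ^ 2) P)
    {w : Sym2 (Fin 2) → ℝ} (hw : ∀ e ∈ G.edgeSet, effectiveResistance G e ≤ w e) {L lam : ℝ}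
    (hL : 0 ≤ L) (hL1 : L ≤ 1) (hlam : (σ : ℝ) ^ 2 * L ≤ lam) :
    L / 25 ≤ P.real {ω | CutsDominate G (fun i => ε i ω) lam w} := by
  rcases hL.eq_or_lt with rfl | hLpos
  · simp
  have hσ' : (0 : ℝ) < σ := hσ
  have hsq : √(8 * L) ^ 2 = 8 * L := Real.sq_sqrt (by positivity)
  -- Closeness at scale `x = √(8 L)` has probability at least `8 L / 196`, which exceeds `L / 25`.
  have hx3 : √(8 * L) ≤ 3 := Real.sqrt_le_iff.2 ⟨by norm_num, by linarith⟩
  have hclose := le_measureReal_abs_sub_lt hσ (hmeas 0)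
    (hindep.indepFun (by decide)) hid hsub (Real.sqrt_pos.2 (by positivity : 0 < 8 * L)) hx3
  rw [hsq] at hclose
  refine le_trans (by linarith) (hclose.trans (measureReal_mono ?_))
  intro ω hω B hB
  have hlt : (ε 0 ω - ε 1 ω) ^ 2 < (σ : ℝ) ^ 2 * (8 * L) := by
    rw [← hsq, ← mul_pow]
    exact sq_lt_sq' (abs_lt.1 hω).1 (abs_lt.1 hω).2
  have hcut := (one_le_sum_cutEdges_effectiveResistance hG hB).trans
    (sum_cutEdges_effectiveResistance_le hw B)
  have hlam0 : 0 ≤ lam := le_trans (by positivity) hlam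
  have hB' : B = {0} ∨ B = {1} := by
    have hall : ∀ B : Finset (Fin 2), B.Nonempty ∧ B ≠ Finset.univ → B = {0} ∨ B = {1} := by
      decide
    exact hall B (mem_properSets.1 hB)
  have hcard : B.card = 1 := by rcases hB' with rfl | rfl <;> rfl
  have hsum : (∑ i ∈ B, (ε i ω - meanVector (fun i => ε i ω) i)) ^ 2
      = (ε 0 ω - ε 1 ω) ^ 2 / 4 := by
    rcases hB' with rfl | rfl <;> simp [meanVector] <;> ring
  rw [hsum, hcard]
  push_cast
  nlinarith

end Main

end GraphPartition

end

/-- For `K* = 1`, with probability at least `1 - w(E)^(-c)` every output of the algorithm induces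
a partition with a single element. The threshold `C₀` and the exponent `c` are absolute. -/
theorem proposition4 :
    ∃ C₀ : ℝ, 0 < C₀ ∧ ∃ c : ℝ, 0 < c ∧
      ∀ Clam : ℝ, C₀ ≤ Clam →
      ∀ (n : ℕ) (G : SimpleGraph (Fin n))
        (Ω : Type*) [MeasurableSpace Ω] (P : Measure Ω) [IsProbabilityMeasure P]
        (Y ε : Fin n → Ω → ℝ) (σ : ℝ≥0) (μstar : Fin n → ℝ)
        (Sstar : Finpartition (Finset.univ : Finset (Fin n))) (f : Finset (Fin n) → ℝ)
        (w : Sym2 (Fin n) → ℝ) (δ τ lam : ℝ),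
        GraphPartition.IsGraphModel P G Y ε σ μstar Sstar f →
        Sstar.parts.card = 1 →
        (∀ e ∈ G.edgeSet, GraphPartition.effectiveResistance G e ≤ w e) →
        0 < δ → δ ≤ (σ : ℝ) / Real.sqrt n →
        0 ≤ τ → τ ≤ (σ : ℝ) ^ 2 →
        lam = Clam * (σ : ℝ) ^ 2 * Real.log (GraphPartition.totalWeight G w) →
        ∃ A : Set Ω, MeasurableSet A ∧
          1 - (GraphPartition.totalWeight G w) ^ (-c) ≤ P.real A ∧
          ∀ ω ∈ A, ∀ μhat : Fin n → ℝ,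
            GraphPartition.IsPottsOutput G (fun i => Y i ω) δ τ lam w μhat →
            (GraphPartition.inducedPartition μhat).parts.card = 1 := by
  -- The 5 serves the case `2 ≤ W`; the exponent `1 / 25` is the constant of the two-vertex case.
  refine ⟨5, by norm_num, 1 / 25, by norm_num, ?_⟩
  intro C hC n G Ω _ P _ Y ε σ μstar Sstar f w δ τ lam hmodel hcard hw _ _ hτ _ hlam
  have hG := hmodel.connected
  have : Nonempty (Fin n) := hG.nonempty
  set W := GraphPartition.totalWeight G w with hWdef
  obtain ⟨m, hm⟩ : ∃ m, ∀ i, μstar i = m := by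
    obtain ⟨A, hA⟩ := Finset.card_eq_one.1 hcard
    have hAmem : A ∈ Sstar.parts := by simp [hA]
    refine ⟨f A, fun i => hmodel.signal.value A hAmem i ?_⟩
    obtain ⟨B, hB, hi⟩ := Sstar.exists_mem (Finset.mem_univ i)
    rw [hA, Finset.mem_singleton] at hB
    exact hB ▸ hi
  have hY : ∀ ω, (fun i => Y i ω) = fun i => m + ε i ω := fun ω => by
    ext i
    rw [hmodel.observation, hm]
  refine ⟨{ω | GraphPartition.CutsDominate G (fun i => ε i ω) lam w},
    GraphPartition.measurableSet_cutsDominate G hmodel.measurable_noise lam w, ?_, ?_⟩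
  · have hcardW : (n : ℝ) - 1 ≤ W := by
      simpa using GraphPartition.card_sub_one_le_totalWeight hG hw
    have hn0 : n ≠ 0 := by
      rintro rfl
      exact isEmptyElim (Classical.arbitrary (Fin 0))
    obtain hW | hW := le_or_gt 2 W
    · rw [hlam]
      refine le_trans ?_ (GraphPartition.le_measureReal_cutsDominate_of_two_le hG hmodel.sigma_pos
        hmodel.measurable_noise hmodel.independent hmodel.subGaussian hw hC hW)
      exact sub_le_sub_left
        (Real.rpow_le_rpow_of_exponent_le (by linarith) (by norm_num)) _
    · have hn3 : n < 3 := by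
        have : (n : ℝ) < 3 := by linarith
        exact_mod_cast this
      obtain rfl | rfl : n = 1 ∨ n = 2 := by omega
      -- A single vertex has no proper vertex sets, so domination holds vacuously.
      · have huniv : {ω | GraphPartition.CutsDominate G (fun i => ε i ω) lam w} = Set.univ := by
          refine Set.eq_univ_of_forall fun ω B hB => ?_
          rw [GraphPartition.mem_properSets] at hB
          exact absurd hB.1.eq_univ hB.2
        have hW0 : 0 ≤ W := by simpa using hcardW
        rw [huniv, probReal_univ, sub_le_self_iff]
        positivity
      · have hW1 : 1 ≤ W := by norm_num at hcardW; exact hcardW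
        have hWpos : 0 < W := by linarith
        have hL : 0 ≤ Real.log W := Real.log_nonneg hW1
        have hL1 : Real.log W ≤ 1 := (Real.log_le_sub_one_of_pos hWpos).trans (by linarith)
        have hlam' : (σ : ℝ) ^ 2 * Real.log W ≤ lam := by
          rw [hlam, mul_assoc]
          exact le_mul_of_one_le_left (by positivity) (by linarith)
        refine le_trans ?_ (GraphPartition.le_measureReal_cutsDominate_fin_two hG hmodel.sigma_pos
          hmodel.measurable_noise hmodel.independent (hmodel.identDistrib 0 1)
          (hmodel.subGaussian 0) hw hL hL1 hlam')
        rw [Real.rpow_def_of_pos hWpos]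
        -- `1 - W ^ (-1/25) ≤ log W / 25`, so a success probability linear in `log W` suffices.
        linarith [Real.add_one_le_exp (Real.log W * -(1 / 25))]
  · intro ω hω μhat hout
    refine GraphPartition.card_inducedPartition_of_const (hout.const ?_ hτ)
    rw [hY, GraphPartition.cutsDominate_add_const_iff]
    exact hω
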